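/- Let $D>0$. For integers $S\ge1$ and $n\ge 1$ let $p=(\tfrac1S,\dots,\tfrac1S)\in\mathbb R^S$, let $\hat p_n\sim\frac1n\mathrm{Multinomial}(n,p)$, and put $$Z_n=\max_{v\in[0,D]^S}(\hat p_n-p)^{\mathsf T}v .$$ For every $S\ge 1$ the random variables $\sqrt n\,Z_n$ converge in distribution as $n\to\infty$; let $Z_S$ be a random variable with the limit law. Then: (a) For all $S\ge1$ and $\delta\in(0,1)$, $$\mathbb P\Big[Z_S\ \ge\ \tfrac D2\Big(\sqrt{\tfrac{2(S-1)}{\pi}}-\sqrt{2\log(2/\delta)}\Big)\Big]\ \ge\ 1-\delta .$$ If $D\ge2$ (in particular if $D=2$, where $Z_n=\|\hat p_n-p\|_1$), then also, for all $S\ge1$ and $\delta\in(0,1)$, $$\mathbb P\Big[Z_S\ \ge\ \sqrt{\tfrac{2(S-1)}{\pi}}-\sqrt{2\log(2/\delta)}\Big]\ \ge\ 1-\delta .$$ (b) Every quantile of $Z_S$ grows like $\sqrt S$: for each $\alpha\in(0,1)$ there are constants $c,C>0$ (which may depend on $\alpha$ and $D$) such that the $\alpha$-quantile $q_\alpha(Z_S)=\inf\{x:\mathbb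 P[Z_S\le x]\ge\alpha\}$ satisfies $c\sqrt S\le q_\alpha(Z_S)\le C\sqrt S$ for all sufficiently large $S$. (c) The dimension-free bound $\mathbb P\big[\|\hat p_n-p\|_1\ge\sqrt{2\log(1/\delta)/n}\big]\le\delta$ claimed in the earlier literature fails: for each $\delta\in(0,1)$ and all sufficiently large $S$ there is $n_0$ such that for all $n\ge n_0$ $$\mathbb P\Big[\|\hat p_n-p\|_1\ge\sqrt{\tfrac{2\log(1/\delta)}{n}}\Big]>\delta .$$ -/

import Mathlib

open MeasureTheory ProbabilityTheory Filter Topology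

noncomputable section

/-- The uniform probability vector `(1/S, …, 1/S)`. -/
def uniformVec (S : ℕ) : Fin S → ℝ := fun _ => 1 / (S : ℝ)

/-- The distribution of one trial on `{1, …, S}` with outcome probabilities `p`. -/
def categorical {S : ℕ} (p : Fin S → ℝ) : Measure (Fin S) :=
  ∑ i, ENNReal.ofReal (p i) • Measure.dirac i

/-- The vector of the numbers of occurrences of each outcome in a sample of size `n`. -/
def counts {n S : ℕ} (x : Fin n → Fin S) : Fin S → ℕ :=
  fun i => (Finset.univ.filter fun j => x j = i).card

/-- `Multinomial(n, p)`: the law of the counts of `n` independent trials with law `p`. -/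
def multinomial {S : ℕ} (n : ℕ) (p : Fin S → ℝ) : Measure (Fin S → ℕ) :=
  (Measure.pi fun _ : Fin n => categorical p).map counts

/-- The law `(1/n) Multinomial(n, p)` on `ℝ^S`. (For `n = 0` it is the point mass at `0`.) -/
def empiricalLaw {S : ℕ} (n : ℕ) (p : Fin S → ℝ) : Measure (Fin S → ℝ) :=
  (multinomial n p).map fun k i => (k i : ℝ) / (n : ℝ)

/-- `max_{v ∈ [0, D]^S} (q - p)ᵀ v`. -/
def maxDev {S : ℕ} (D : ℝ) (p q : Fin S → ℝ) : ℝ :=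
  sSup ((fun v : Fin S → ℝ => ∑ i, (q i - p i) * v i) '' {v | ∀ i, v i ∈ Set.Icc 0 D})

/-- For `0 ≤ D` the supremum in `maxDev` is a maximum. -/
theorem isGreatest_maxDev {S : ℕ} {D : ℝ} (hD : 0 ≤ D) (p q : Fin S → ℝ) :
    IsGreatest ((fun v : Fin S → ℝ => ∑ i, (q i - p i) * v i) ''
      {v | ∀ i, v i ∈ Set.Icc 0 D}) (maxDev D p q) := by
  have hc : IsCompact {v : Fin S → ℝ | ∀ i, v i ∈ Set.Icc 0 D} :=
    isCompact_pi_infinite fun _ => isCompact_Icc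
  have hne : {v : Fin S → ℝ | ∀ i, v i ∈ Set.Icc 0 D}.Nonempty :=
    ⟨fun _ => 0, fun _ => ⟨le_rfl, hD⟩⟩
  exact (hc.image (by fun_prop)).isGreatest_sSup (hne.image _)

/-- The `α`-quantile `inf {x | α ≤ F(x)}` of a law on `ℝ` with distribution function `F`. -/
def quantile (ν : Measure ℝ) (α : ℝ) : ℝ := sInf {x | α ≤ ν.real (Set.Iic x)}

end

/-! Frequencies and `p` have equal total mass, so the maximum over the cube is `D / 2` times the ℓ¹
distance (`maxDev_eq_sum_abs`). The central limit theorem and continuous mapping then give `Z_S = (D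
/ 2) ‖G‖₁`, where `G` is a centred Gaussian with covariance `uniformCov S`. Summing the coordinates'
absolute moments gives `E ‖G‖₁ = √(2(S - 1)/π)`, of order `√S`.

Fluctuations around the mean do not grow with `S`. This is proved for finite samples instead of
through Gaussian concentration: replacing one observation moves `√n ‖p̂ - p‖₁` by at most `2/√n`, so
McDiarmid gives a lower tail `exp(-t²/2)` free of `n` and `S` (`sumAbs_scaledDev_lower_tail`). The
means satisfy `liminf ≥ E ‖G‖₁`, and the portmanteau theorem carries the tail to `G` at an
arbitrarily small cost in `t` (`uniformGaussian_lower_tail`); the gap between `log (1/δ)` and `log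
(2/δ)` pays for it.

The tail bounds quantiles from below and Markov's inequality bounds them from above. The
finite-sample tail, with means of order `√S`, refutes the dimension-free bound. -/

/-! ### Concentration for independent samples, and a Gaussian moment. -/

/-- Fubini for a power of a law on a finite type, the first coordinate being integrated first. -/
theorem integral_pi_fin_succ {α : Type*} [MeasurableSpace α] [Finite α]
    [MeasurableSingletonClass α] (μ : Measure α) [IsProbabilityMeasure μ] {n : ℕ}
    (F : (Fin (n + 1) → α) → ℝ) :
    ∫ x, F x ∂(Measure.pi fun _ => μ) =
      ∫ x, ∫ a, F (Fin.cons a x) ∂μ ∂(Measure.pi fun _ : Fin n => μ) := by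
  have h := (measurePreserving_piFinSuccAbove (fun _ : Fin (n + 1) => μ) 0).symm
  rw [← h.integral_comp', integral_prod_symm _ .of_finite]
  simp [MeasurableEquiv.piFinSuccAbove_symm_apply, Fin.consEquiv]

/-- **McDiarmid's bounded differences inequality**, for functions of independent and identically
distributed variables with values in a finite type. -/
theorem hasSubgaussianMGF_of_bounded_differences {α : Type*} [MeasurableSpace α] [Finite α]
    [MeasurableSingletonClass α] (μ : Measure α) [IsProbabilityMeasure μ] {n : ℕ}
    (f : (Fin n → α) → ℝ) (c : Fin n → NNReal)
    (hf : ∀ x i a, |f (Function.update x i a) - f x| ≤ c i) :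
    HasSubgaussianMGF (fun x => f x - ∫ y, f y ∂(Measure.pi fun _ => μ)) (∑ i, (c i / 2) ^ 2)
      (Measure.pi fun _ => μ) := by
  induction n with
  | zero =>
    have h : (fun x => f x - ∫ y, f y ∂(Measure.pi fun _ : Fin 0 => μ)) = fun _ => 0 := by
      funext x
      have hc : f = fun _ => f x := funext fun y => congrArg f (Subsingleton.elim y x)
      rw [hc]
      simp
    rw [h]
    simp
  | succ n ih =>
    refine ⟨fun t => .of_finite, fun t => ?_⟩
    set g : (Fin n → α) → ℝ := fun x => ∫ a, f (Fin.cons a x) ∂μ with hg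
    -- Averaging out the first coordinate preserves the bounded differences in the others.
    have hgc : ∀ x i a, |g (Function.update x i a) - g x| ≤ c i.succ := fun x i a => by
      have hs : g (Function.update x i a) - g x =
          ∫ b, (f (Fin.cons b (Function.update x i a)) - f (Fin.cons b x)) ∂μ :=
        (integral_sub .of_finite .of_finite).symm
      rw [hs, ← Real.norm_eq_abs]
      refine (norm_integral_le_of_norm_le_const (μ := μ) (C := c i.succ) (ae_of_all _ fun b => ?_)).trans ?_
      · rw [Real.norm_eq_abs, Fin.cons_update]
        exact hf _ _ _
      · simp
    have hcond : ∀ x, ∫ a, Real.exp (t * (f (Fin.cons a x) - g x)) ∂μ ≤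
        Real.exp (((c 0 / 2) ^ 2 : NNReal) * t ^ 2 / 2) := fun x => by
      obtain ⟨b⟩ : Nonempty α := μ.nonempty_of_neZero
      have : Nonempty α := ⟨b⟩
      -- Starting at the minimum gives an interval of length `c 0`, rather than `2 * c 0`, for
      -- Hoeffding's lemma.
      obtain ⟨a₀, ha₀⟩ := Finite.exists_min fun a => f (Fin.cons a x)
      have hb : ∀ᵐ a ∂μ, f (Fin.cons a x) ∈
          Set.Icc (f (Fin.cons a₀ x)) (f (Fin.cons a₀ x) + c 0) := ae_of_all _ fun a => by
        have h := hf (Fin.cons a₀ x) 0 a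
        rw [Fin.update_cons_zero] at h
        exact ⟨ha₀ a, by linarith [le_of_abs_le h]⟩
      have h := (hasSubgaussianMGF_of_mem_Icc .of_discrete hb).mgf_le t
      rw [add_sub_cancel_left, NNReal.nnnorm_eq] at h
      exact h
    have hE : ∫ y, f y ∂(Measure.pi fun _ : Fin (n + 1) => μ) =
        ∫ x, g x ∂(Measure.pi fun _ : Fin n => μ) := integral_pi_fin_succ μ f
    rw [mgf, integral_pi_fin_succ, hE, Fin.sum_univ_succ]
    set m := ∫ x, g x ∂(Measure.pi fun _ : Fin n => μ)
    calc ∫ x, ∫ a, Real.exp (t * (f (Fin.cons a x) - m)) ∂μ ∂(Measure.pi fun _ : Fin n => μ)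
        = ∫ x, Real.exp (t * (g x - m)) * ∫ a, Real.exp (t * (f (Fin.cons a x) - g x)) ∂μ
            ∂(Measure.pi fun _ : Fin n => μ) := by
          refine integral_congr_ae (ae_of_all _ fun x => ?_)
          simp only
          rw [← integral_const_mul]
          refine integral_congr_ae (ae_of_all _ fun a => ?_)
          simp only
          rw [← Real.exp_add]
          congr 1
          ring
      _ ≤ ∫ x, Real.exp (t * (g x - m)) * Real.exp (((c 0 / 2) ^ 2 : NNReal) * t ^ 2 / 2)
            ∂(Measure.pi fun _ : Fin n => μ) :=
          integral_mono .of_finite .of_finite fun x =>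
            mul_le_mul_of_nonneg_left (hcond x) (Real.exp_nonneg _)
      _ ≤ Real.exp ((∑ i : Fin n, (c i.succ / 2) ^ 2 : NNReal) * t ^ 2 / 2) *
            Real.exp (((c 0 / 2) ^ 2 : NNReal) * t ^ 2 / 2) := by
          rw [integral_mul_const]
          exact mul_le_mul_of_nonneg_right ((ih g (fun i => c i.succ) hgc).mgf_le t)
            (Real.exp_nonneg _)
      _ = _ := by
          rw [← Real.exp_add]
          congr 1
          push_cast
          ring

/-- The first absolute moment of a centred Gaussian. -/
theorem integral_abs_gaussianReal (v : NNReal) :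
    ∫ x, |x| ∂(gaussianReal 0 v) = √(2 * v / Real.pi) := by
  rcases eq_or_ne v 0 with rfl | hv
  · simp
  have hv' : (0 : ℝ) < v := by positivity
  have hI : ∫ r in Set.Ioi (0 : ℝ), r * Real.exp (-(2 * v : ℝ)⁻¹ * r ^ 2) = v := by
    have h := integral_mul_cexp_neg_mul_sq (b := (((2 * v : ℝ)⁻¹ : ℝ) : ℂ))
      (by rw [Complex.ofReal_re]; positivity)
    have h2 : ∫ r in Set.Ioi (0 : ℝ), ((r * Real.exp (-(2 * v : ℝ)⁻¹ * r ^ 2) : ℝ) : ℂ) =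
        ((v : ℝ) : ℂ) := by
      push_cast at h ⊢
      rw [h]
      field_simp
    rw [integral_complex_ofReal] at h2
    exact_mod_cast h2
  rw [integral_gaussianReal_eq_integral_smul hv]
  have h : ∀ x : ℝ, gaussianPDFReal 0 v x • |x| =
      (fun y => (√(2 * Real.pi * v))⁻¹ * (y * Real.exp (-(2 * v : ℝ)⁻¹ * y ^ 2))) |x| := fun x => by
    simp only [gaussianPDFReal, smul_eq_mul, sub_zero, sq_abs]
    rw [show -x ^ 2 / (2 * v : ℝ) = -(2 * v : ℝ)⁻¹ * x ^ 2 by ring]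
    ring
  simp_rw [h]
  rw [integral_comp_abs (f := fun y => (√(2 * Real.pi * v))⁻¹ *
    (y * Real.exp (-(2 * v : ℝ)⁻¹ * y ^ 2))), integral_const_mul, hI]
  symm
  rw [Real.sqrt_eq_iff_mul_self_eq (by positivity) (by positivity)]
  have h3 : 0 < √(2 * Real.pi * v) := by positivity
  field_simp
  rw [pow_two]
  exact Real.mul_self_sqrt (by positivity)

/-! ### Frequencies of a uniform sample. -/

theorem isProbabilityMeasure_categorical_uniformVec {S : ℕ} (hS : 1 ≤ S) :
    IsProbabilityMeasure (categorical (uniformVec S)) := by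
  refine ⟨?_⟩
  have hS' : (S : ℝ) ≠ 0 := by positivity
  simp only [categorical, uniformVec, Measure.coe_finsetSum, Measure.coe_smul, Finset.sum_apply,
    Pi.smul_apply, measure_univ, smul_eq_mul, mul_one]
  rw [← ENNReal.ofReal_sum_of_nonneg fun _ _ => by positivity]
  simp [hS']

theorem integral_categorical_uniformVec {S : ℕ} (f : Fin S → ℝ) :
    ∫ k, f k ∂(categorical (uniformVec S)) = 1 / (S : ℝ) * ∑ i, f i := by
  rw [categorical, integral_finsetSum_measure fun i _ =>
    (Integrable.of_finite (μ := Measure.dirac i)).smul_measure ENNReal.ofReal_ne_top,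
    Finset.mul_sum]
  refine Finset.sum_congr rfl fun i _ => ?_
  rw [integral_smul_measure, integral_dirac, uniformVec,
    ENNReal.toReal_ofReal (by positivity), smul_eq_mul]

/-- The vector of the relative frequencies in a sample. -/
noncomputable def frequencies {n S : ℕ} (x : Fin n → Fin S) : Fin S → ℝ := fun i => (counts x i : ℝ) / (n : ℝ)

theorem empiricalLaw_eq_map {S : ℕ} (n : ℕ) (p : Fin S → ℝ) :
    empiricalLaw n p = (Measure.pi fun _ : Fin n => categorical p).map frequencies := by
  rw [empiricalLaw, multinomial, Measure.map_map .of_discrete .of_discrete]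
  rfl

theorem counts_eq_sum {n S : ℕ} (x : Fin n → Fin S) (i : Fin S) :
    (counts x i : ℝ) = ∑ j, if x j = i then 1 else 0 := by
  simp [counts]

theorem sum_counts_mul {n S : ℕ} (x : Fin n → Fin S) (t : Fin S → ℝ) :
    ∑ i, (counts x i : ℝ) * t i = ∑ j, t (x j) := by
  simp_rw [counts_eq_sum, Finset.sum_mul]
  rw [Finset.sum_comm]
  simp

theorem sum_frequencies {n S : ℕ} (hn : 1 ≤ n) (x : Fin n → Fin S) :
    ∑ i, frequencies x i = 1 := by
  have h := sum_counts_mul x fun _ => 1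
  have hn' : (n : ℝ) ≠ 0 := by positivity
  simp only [mul_one, Finset.sum_const, Finset.card_univ, Fintype.card_fin, nsmul_eq_mul] at h
  simp only [frequencies]
  rw [← Finset.sum_div, h, div_self hn']

/-- The deviation of the frequencies from `(1/S, …, 1/S)`, multiplied by `√n`. -/
noncomputable def scaledDev {n S : ℕ} (x : Fin n → Fin S) : EuclideanSpace ℝ (Fin S) :=
  WithLp.toLp 2 fun i => √(n : ℝ) * (frequencies x i - uniformVec S i)

/-- A linear functional of the deviation is a sum of i.i.d. centred terms, so its characteristic
function is an `n`-th power. -/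
theorem inner_scaledDev {n S : ℕ} (x : Fin n → Fin S) (t : EuclideanSpace ℝ (Fin S)) :
    inner ℝ (scaledDev x) t = ∑ j, (√(n : ℝ))⁻¹ * (t (x j) - 1 / (S : ℝ) * ∑ i, t i) := by
  rw [PiLp.inner_apply]
  rcases Nat.eq_zero_or_pos n with rfl | hn
  · simp [scaledDev]
  have hn' : (0 : ℝ) < n := by positivity
  have h : ∀ i, inner ℝ (scaledDev x i) (t i) =
      (√(n : ℝ))⁻¹ * ((counts x i : ℝ) * t i - n * (1 / (S : ℝ) * t i)) := fun i => by
    have h2 : √(n : ℝ) * √(n : ℝ) = n := Real.mul_self_sqrt hn'.le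
    have h3 : √(n : ℝ) ≠ 0 := by positivity
    simp only [scaledDev, frequencies, uniformVec, RCLike.inner_apply, conj_trivial]
    field_simp
    rw [pow_two, h2]
  simp_rw [h]
  rw [← Finset.mul_sum, ← Finset.mul_sum, Finset.sum_sub_distrib, Finset.sum_sub_distrib,
    sum_counts_mul, ← Finset.mul_sum, ← Finset.mul_sum]
  simp

/-! ### The central limit theorem for the frequencies. -/

/-- The powers of the characteristic function in the central limit theorem, for an arbitrary
variance. -/
theorem tendsto_charFun_inv_sqrt_pow {Ω : Type*} [MeasurableSpace Ω] {P : Measure Ω}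
    [IsProbabilityMeasure P] {X : Ω → ℝ} (hX : AEMeasurable X P) (h0 : ∫ ω, X ω ∂P = 0)
    (h2 : Integrable (fun ω => X ω ^ 2) P) :
    Tendsto (fun n : ℕ => charFun (P.map X) (√(n : ℝ))⁻¹ ^ n) atTop
      (𝓝 (Complex.exp (-((∫ ω, X ω ^ 2 ∂P : ℝ) : ℂ) / 2))) := by
  set v := ∫ ω, X ω ^ 2 ∂P with hv
  -- Variance zero cannot be normalised; there `X` vanishes almost everywhere. Otherwise `X / √v` is
  -- evaluated at `√v`.
  rcases eq_or_ne v 0 with hv0 | hv0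
  · have hX0 : X =ᵐ[P] fun _ => 0 := by
      filter_upwards [(integral_eq_zero_iff_of_nonneg (fun ω => sq_nonneg (X ω)) h2).1 hv0]
        with ω hω
      simpa using hω
    rw [Measure.map_congr hX0, hv0]
    simp
  · have hv1 : 0 < v := lt_of_le_of_ne (integral_nonneg fun ω => sq_nonneg _) hv0.symm
    have hs : √v ≠ 0 := by positivity
    have hsv : √v ^ 2 = v := Real.sq_sqrt hv1.le
    have h := tendsto_charFun_inv_sqrt_mul_pow (P := P) (X := fun ω => (√v)⁻¹ * X ω)
      (hX.const_mul _) (by rw [integral_const_mul, h0, mul_zero])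
      (by
        simp only [Pi.pow_apply, mul_pow]
        rw [integral_const_mul, ← hv, inv_pow, hsv, inv_mul_cancel₀ hv0]) (√v)
    have hm : ∀ s : ℝ, charFun (P.map fun ω => (√v)⁻¹ * X ω) (s * √v) = charFun (P.map X) s :=
      fun s => by
        rw [charFun_map_mul_comp hX]
        congr 1
        field_simp
    simp_rw [hm] at h
    rw [← Complex.ofReal_pow, hsv] at h
    exact h

/-- The covariance matrix of one trial with the uniform law. -/
noncomputable def uniformCov (S : ℕ) : Matrix (Fin S) (Fin S) ℝ :=
  (1 / (S : ℝ)) • 1 - Matrix.of fun _ _ => 1 / (S : ℝ) ^ 2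

/-- The right side is the variance of `t` at one uniform trial: it is visibly nonnegative and is the
variance that the central limit theorem produces. -/
theorem dotProduct_uniformCov {S : ℕ} (hS : 1 ≤ S) (t : Fin S → ℝ) :
    t ⬝ᵥ (uniformCov S).mulVec t =
      1 / (S : ℝ) * ∑ i, (t i - 1 / (S : ℝ) * ∑ j, t j) ^ 2 := by
  have hS' : (S : ℝ) ≠ 0 := by positivity
  have h1 : (Matrix.of fun _ _ : Fin S => 1 / (S : ℝ) ^ 2).mulVec t =
      fun _ => 1 / (S : ℝ) ^ 2 * ∑ j, t j := by
    ext i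
    simp [Matrix.mulVec, dotProduct, Finset.mul_sum]
  rw [uniformCov, Matrix.sub_mulVec, h1, Matrix.smul_mulVec, Matrix.one_mulVec]
  simp only [dotProduct, Pi.sub_apply, Pi.smul_apply, smul_eq_mul, mul_sub, sub_sq,
    Finset.sum_add_distrib, Finset.sum_sub_distrib, ← Finset.sum_mul, Finset.sum_const,
    Finset.card_univ, Fintype.card_fin, nsmul_eq_mul, ← Finset.mul_sum]
  have h2 : ∑ i, t i * (1 / (S : ℝ) * t i) = 1 / (S : ℝ) * ∑ i, t i ^ 2 := by
    rw [Finset.mul_sum]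
    exact Finset.sum_congr rfl fun i _ => by ring
  rw [h2]
  field_simp
  ring

theorem posSemidef_uniformCov {S : ℕ} (hS : 1 ≤ S) : (uniformCov S).PosSemidef := by
  refine Matrix.PosSemidef.of_dotProduct_mulVec_nonneg ?_ fun t => ?_
  · ext i j
    simp [uniformCov, Matrix.one_apply, eq_comm]
  · rw [star_trivial, dotProduct_uniformCov hS]
    positivity

/-- The Gaussian limit of `√n (p̂ - p)`. -/
noncomputable abbrev uniformGaussian (S : ℕ) : Measure (EuclideanSpace ℝ (Fin S)) :=
  multivariateGaussian 0 (uniformCov S)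

theorem tendsto_charFun_scaledDev {S : ℕ} (hS : 1 ≤ S) (t : EuclideanSpace ℝ (Fin S)) :
    Tendsto (fun n : ℕ => charFun
      ((Measure.pi fun _ : Fin n => categorical (uniformVec S)).map scaledDev) t) atTop
      (𝓝 (charFun (uniformGaussian S) t)) := by
  have := isProbabilityMeasure_categorical_uniformVec hS
  have hS' : (S : ℝ) ≠ 0 := by positivity
  have h := tendsto_charFun_inv_sqrt_pow (P := categorical (uniformVec S))
    (X := fun k => t k - 1 / (S : ℝ) * ∑ i, t i) .of_discrete
    (by
      rw [integral_categorical_uniformVec, Finset.sum_sub_distrib]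
      simp [hS']) .of_finite
  rw [charFun_multivariateGaussian (posSemidef_uniformCov hS), dotProduct_uniformCov hS]
  rw [integral_categorical_uniformVec] at h
  convert h using 2 with n
  · rw [charFun_apply, charFun_apply_real, integral_map .of_discrete (by fun_prop),
      integral_map .of_discrete (by fun_prop)]
    simp_rw [inner_scaledDev, Complex.ofReal_sum, Finset.sum_mul, Complex.exp_sum]
    rw [integral_fintype_prod_eq_pow (fun k : Fin S => Complex.exp
      (((√(n : ℝ))⁻¹ * (t k - 1 / (S : ℝ) * ∑ i, t i) : ℝ) * Complex.I)), Fintype.card_fin]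
    simp
  · congr 1
    simp
    ring

instance {n S : ℕ} {μ : Measure (Fin n → Fin S)} [IsProbabilityMeasure μ] :
    IsProbabilityMeasure (μ.map scaledDev) :=
  Measure.isProbabilityMeasure_map Measurable.of_discrete.aemeasurable

/-! ### The ℓ¹ norm and its Gaussian mean. -/

/-- The `ℓ¹` norm on `ℝ^S`. -/
noncomputable def sumAbs {S : ℕ} (v : EuclideanSpace ℝ (Fin S)) : ℝ := ∑ i, |v i|

theorem sumAbs_nonneg {S : ℕ} (v : EuclideanSpace ℝ (Fin S)) : 0 ≤ sumAbs v :=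
  Finset.sum_nonneg fun _ _ => abs_nonneg _

@[fun_prop]
theorem continuous_sumAbs {S : ℕ} : Continuous (sumAbs (S := S)) := by
  unfold sumAbs
  fun_prop

@[fun_prop]
theorem measurable_sumAbs {S : ℕ} : Measurable (sumAbs (S := S)) :=
  continuous_sumAbs.measurable

theorem sumAbs_scaledDev {n S : ℕ} (x : Fin n → Fin S) :
    sumAbs (scaledDev x) = √(n : ℝ) * ∑ i, |frequencies x i - uniformVec S i| := by
  simp [sumAbs, scaledDev, abs_mul, Finset.mul_sum, abs_of_nonneg (Real.sqrt_nonneg _)]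

theorem integrable_sumAbs_uniformGaussian (S : ℕ) : Integrable sumAbs (uniformGaussian S) := by
  refine integrable_finsetSum _ fun i _ => Integrable.abs ?_
  exact (EuclideanSpace.proj (𝕜 := ℝ) i).integrable_comp IsGaussian.integrable_id

/-- Each of the `S` coordinates is a centred Gaussian of variance `(S - 1)/S²`. -/
theorem integral_sumAbs_uniformGaussian {S : ℕ} (hS : 1 ≤ S) :
    ∫ v, sumAbs v ∂(uniformGaussian S) = √(2 * ((S : ℝ) - 1) / Real.pi) := by
  have hS' : (1 : ℝ) ≤ S := by exact_mod_cast hS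
  have hi : ∀ i : Fin S, ∫ v : EuclideanSpace ℝ (Fin S), |v i| ∂(uniformGaussian S) =
      √(2 * ((S : ℝ) - 1) / Real.pi) / S := fun i => by
    have h := measurePreserving_eval_multivariateGaussian (μ := 0) (posSemidef_uniformCov hS)
      (i := i)
    have hv : uniformCov S i i = ((S : ℝ) - 1) / (S : ℝ) ^ 2 := by
      simp only [uniformCov, Matrix.sub_apply, Matrix.smul_apply, Matrix.one_apply_eq,
        Matrix.of_apply, smul_eq_mul, mul_one]
      field_simp
    rw [← integral_map (f := fun x : ℝ => |x|) h.measurable.aemeasurable (by fun_prop), h.map_eq,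
      PiLp.zero_apply, integral_abs_gaussianReal, hv,
      Real.coe_toNNReal _ (div_nonneg (by linarith) (by positivity)),
      ← Real.sqrt_sq (x := (S : ℝ)) (by positivity), ← Real.sqrt_div' _ (by positivity),
      Real.sqrt_sq (x := (S : ℝ)) (by positivity)]
    congr 1
    ring
  unfold sumAbs
  rw [integral_finsetSum]
  · simp_rw [hi]
    simp only [Finset.sum_const, Finset.card_univ, Fintype.card_fin, nsmul_eq_mul]
    field_simp
  · exact fun i _ => Integrable.abs
      ((EuclideanSpace.proj (𝕜 := ℝ) i).integrable_comp IsGaussian.integrable_id)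

/-- The law of a sample of size `n` from the uniform law on `Fin S`. -/
noncomputable abbrev sampleLaw (n S : ℕ) : Measure (Fin n → Fin S) :=
  Measure.pi fun _ => categorical (uniformVec S)

theorem isProbabilityMeasure_sampleLaw (n : ℕ) {S : ℕ} (hS : 1 ≤ S) :
    IsProbabilityMeasure (sampleLaw n S) := by
  have := isProbabilityMeasure_categorical_uniformVec hS
  infer_instance

theorem tendsto_map_scaledDev {S : ℕ} (hS : 1 ≤ S)
    [∀ n, IsProbabilityMeasure ((sampleLaw n S).map scaledDev)] :
    Tendsto (β := ProbabilityMeasure (EuclideanSpace ℝ (Fin S)))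
      (fun n => ⟨(sampleLaw n S).map scaledDev, inferInstance⟩) atTop
      (𝓝 ⟨uniformGaussian S, inferInstance⟩) :=
  ProbabilityMeasure.tendsto_of_tendsto_charFun (tendsto_charFun_scaledDev hS)

/-! ### Lower tail of the ℓ¹ deviation, for samples and in the limit. -/

/-- Replacing an observation takes one unit from one count and gives it to another, a change of at
most `2/n` in ℓ¹ before scaling. -/
theorem abs_sumAbs_scaledDev_update_sub_le {n S : ℕ} (x : Fin n → Fin S) (k : Fin n)
    (a : Fin S) :
    |sumAbs (scaledDev (Function.update x k a)) - sumAbs (scaledDev x)| ≤ 2 / √(n : ℝ) := by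
  have hn : (0 : ℝ) < n := by exact_mod_cast k.pos
  have hc : ∀ i, (counts (Function.update x k a) i : ℝ) - counts x i =
      (if a = i then 1 else 0) - if x k = i then 1 else 0 := fun i => by
    rw [counts_eq_sum, counts_eq_sum, ← Finset.sum_sub_distrib, Finset.sum_eq_single k]
    · simp
    · intro j _ hj
      simp [Function.update_of_ne hj]
    · simp
  have hd : ∑ i, |frequencies (Function.update x k a) i - frequencies x i| ≤ 2 / n := by
    calc ∑ i, |frequencies (Function.update x k a) i - frequencies x i|
        ≤ ∑ i, ((if a = i then (1 : ℝ) else 0) + if x k = i then 1 else 0) / n := by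
          refine Finset.sum_le_sum fun i _ => ?_
          rw [frequencies, frequencies, ← sub_div, hc, abs_div, abs_of_pos hn]
          gcongr
          refine (abs_sub _ _).trans (le_of_eq ?_)
          split_ifs <;> simp
      _ = 2 / n := by
          rw [← Finset.sum_div, Finset.sum_add_distrib]
          simp
          norm_num
  have hs : √(n : ℝ) * √(n : ℝ) = n := Real.mul_self_sqrt hn.le
  rw [sumAbs_scaledDev, sumAbs_scaledDev, ← mul_sub, abs_mul, abs_of_nonneg (Real.sqrt_nonneg _),
    ← Finset.sum_sub_distrib]
  calc √(n : ℝ) * |∑ i, (|frequencies (Function.update x k a) i - uniformVec S i| -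
          |frequencies x i - uniformVec S i|)|
      ≤ √(n : ℝ) * (2 / n) := by
        gcongr
        refine ((Finset.abs_sum_le_sum_abs _ _).trans (Finset.sum_le_sum fun i _ => ?_)).trans hd
        refine (abs_abs_sub_abs_le_abs_sub _ _).trans (le_of_eq ?_)
        congr 1
        ring
    _ = 2 / √(n : ℝ) := by
        have h3 : √(n : ℝ) ≠ 0 := by positivity
        rw [mul_div_assoc', div_eq_div_iff hn.ne' h3]
        linear_combination 2 * hs

theorem sumAbs_scaledDev_lower_tail {n S : ℕ} (hn : 1 ≤ n) (hS : 1 ≤ S) {t : ℝ} (ht : 0 ≤ t) :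
    1 - Real.exp (-t ^ 2 / 2) ≤ (sampleLaw n S).real
      {x | ∫ y, sumAbs (scaledDev y) ∂(sampleLaw n S) - t ≤ sumAbs (scaledDev x)} := by
  have := isProbabilityMeasure_categorical_uniformVec hS
  have hn' : (0 : ℝ) < n := by positivity
  have hs : √(n : ℝ) * √(n : ℝ) = n := Real.mul_self_sqrt hn'.le
  set c : NNReal := NNReal.mk (2 / √(n : ℝ)) (by positivity) with hc
  have h := (hasSubgaussianMGF_of_bounded_differences (categorical (uniformVec S))
    (fun x : Fin n → Fin S => sumAbs (scaledDev x)) (fun _ => c)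
    abs_sumAbs_scaledDev_update_sub_le).neg.measure_ge_le ht
  -- With `c = 2/√n` the variance proxy is `n · (1/√n)² = 1`.
  have hsum : ((∑ _i : Fin n, (c / 2) ^ 2 : NNReal) : ℝ) = 1 := by
    have h3 : √(n : ℝ) ≠ 0 := by positivity
    simp only [Finset.sum_const, Finset.card_univ, Fintype.card_fin, nsmul_eq_mul]
    push_cast
    rw [hc, NNReal.coe_mk]
    field_simp
    rw [pow_two, hs]
  rw [hsum, mul_one] at h
  set m := ∫ y, sumAbs (scaledDev y) ∂(sampleLaw n S) with hm
  have hcompl : {x | m - t ≤ sumAbs (scaledDev x)}ᶜ ⊆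
      {x : Fin n → Fin S | t ≤ (-fun x => sumAbs (scaledDev x) - m) x} := fun x hx => by
    simp only [Set.mem_compl_iff, Set.mem_ofPred_eq, not_le, Pi.neg_apply] at hx ⊢
    linarith
  have h2 := (measureReal_mono (μ := sampleLaw n S) hcompl).trans h
  rw [probReal_compl_eq_one_sub .of_discrete] at h2
  linarith

/-- Only a lower bound on the means is needed, so a Fatou inequality for weak convergence suffices,
without uniform integrability. -/
theorem eventually_lt_integral_sumAbs_scaledDev {S : ℕ} (hS : 1 ≤ S) {a : ℝ}
    (ha : a < √(2 * ((S : ℝ) - 1) / Real.pi)) :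
    ∀ᶠ n : ℕ in atTop, a < ∫ x, sumAbs (scaledDev x) ∂(sampleLaw n S) := by
  rcases lt_or_ge a 0 with h0 | h0
  · exact .of_forall fun _ => h0.trans_le (integral_nonneg fun _ => sumAbs_nonneg _)
  have := fun n => isProbabilityMeasure_sampleLaw n hS
  have h := lintegral_le_liminf_lintegral_of_forall_isOpen_measure_le_liminf_measure
    (μ := uniformGaussian S) (μs := fun n => (sampleLaw n S).map scaledDev) continuous_sumAbs
    sumAbs_nonneg fun G hG =>
      ProbabilityMeasure.le_liminf_measure_open_of_tendsto (tendsto_map_scaledDev hS) hG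
  rw [← ofReal_integral_eq_lintegral_ofReal (integrable_sumAbs_uniformGaussian S)
    (ae_of_all _ sumAbs_nonneg), integral_sumAbs_uniformGaussian hS] at h
  have h2 : ENNReal.ofReal a < _ :=
    ((ENNReal.ofReal_lt_ofReal_iff (h0.trans_lt ha)).2 ha).trans_le h
  filter_upwards [eventually_lt_of_lt_liminf h2] with n hn
  rw [lintegral_map (by fun_prop) .of_discrete, ← ofReal_integral_eq_lintegral_ofReal .of_finite
    (ae_of_all _ fun _ => sumAbs_nonneg _)] at hn
  exact lt_of_not_ge fun hle => hn.not_ge (ENNReal.ofReal_le_ofReal hle)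

theorem uniformGaussian_lower_tail {S : ℕ} (hS : 1 ≤ S) {s t : ℝ} (hs : 0 ≤ s) (hst : s < t) :
    1 - Real.exp (-s ^ 2 / 2) ≤ (uniformGaussian S).real
      {v | √(2 * ((S : ℝ) - 1) / Real.pi) - t ≤ sumAbs v} := by
  have := fun n => isProbabilityMeasure_sampleLaw n hS
  set m := √(2 * ((S : ℝ) - 1) / Real.pi) with hm
  have hF : IsClosed {v : EuclideanSpace ℝ (Fin S) | m - t ≤ sumAbs v} :=
    isClosed_le continuous_const continuous_sumAbs
  have h := ProbabilityMeasure.limsup_measure_closed_le_of_tendsto (tendsto_map_scaledDev hS) hF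
  have h2 : ∀ᶠ n : ℕ in atTop, ENNReal.ofReal (1 - Real.exp (-s ^ 2 / 2)) ≤
      (sampleLaw n S).map scaledDev {v | m - t ≤ sumAbs v} := by
    -- The slack `t - s` absorbs the possible shortfall of the finite-sample mean below `m`.
    filter_upwards [eventually_lt_integral_sumAbs_scaledDev hS (a := m - (t - s))
      (by linarith), eventually_ge_atTop 1] with n hn hn1
    rw [Measure.map_apply .of_discrete hF.measurableSet, ← ofReal_measureReal]
    refine ENNReal.ofReal_le_ofReal ((sumAbs_scaledDev_lower_tail hn1 hS hs).trans
      (measureReal_mono fun x hx => ?_))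
    simp only [Set.mem_preimage, Set.mem_ofPred_eq] at hx ⊢
    linarith
  have h3 : ENNReal.ofReal (1 - Real.exp (-s ^ 2 / 2)) ≤
      uniformGaussian S {v | m - t ≤ sumAbs v} :=
    ((le_liminf_of_le (by isBoundedDefault) h2).trans liminf_le_limsup).trans h
  exact (ENNReal.ofReal_le_iff_le_toReal (measure_ne_top _ _)).1 h3

/-! ### Reduction of the maximum to the ℓ¹ norm. -/

/-- The maximiser is `D` where `q i ≥ p i` and `0` elsewhere; the summand is `D` times the positive
part of `q i - p i`. -/
theorem maxDev_eq_sum {S : ℕ} {D : ℝ} (hD : 0 ≤ D) (p q : Fin S → ℝ) :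
    maxDev D p q = ∑ i, D / 2 * (|q i - p i| + (q i - p i)) := by
  refine (isGreatest_maxDev hD p q).unique ⟨⟨fun i => if p i ≤ q i then D else 0, ?_, ?_⟩, ?_⟩
  · intro i
    dsimp only
    split_ifs
    exacts [⟨hD, le_rfl⟩, ⟨le_rfl, hD⟩]
  · refine Finset.sum_congr rfl fun i _ => ?_
    dsimp only
    split_ifs with h
    · rw [abs_of_nonneg (sub_nonneg.2 h)]
      ring
    · rw [abs_of_neg (sub_neg.2 (not_le.1 h))]
      ring
  · rintro _ ⟨v, hv, rfl⟩
    refine Finset.sum_le_sum fun i _ => ?_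
    obtain ⟨h0, h1⟩ := hv i
    rcases le_total 0 (q i - p i) with h | h
    · rw [abs_of_nonneg h]
      nlinarith [mul_le_mul_of_nonneg_left h1 h]
    · rw [abs_of_nonpos h]
      nlinarith [mul_nonneg h0 (neg_nonneg.2 h)]

theorem measurable_maxDev {S : ℕ} {D : ℝ} (hD : 0 ≤ D) (p : Fin S → ℝ) :
    Measurable (maxDev D p) := by
  have h : maxDev D p = fun q => ∑ i, D / 2 * (|q i - p i| + (q i - p i)) :=
    funext (maxDev_eq_sum hD p)
  rw [h]
  fun_prop

theorem maxDev_eq_sum_abs {S : ℕ} {D : ℝ} (hD : 0 ≤ D) {p q : Fin S → ℝ}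
    (h : ∑ i, q i = ∑ i, p i) : maxDev D p q = D / 2 * ∑ i, |q i - p i| := by
  rw [maxDev_eq_sum hD, ← Finset.mul_sum, Finset.sum_add_distrib, Finset.sum_sub_distrib, h,
    sub_self, add_zero]

theorem sqrt_mul_maxDev_frequencies {n S : ℕ} (hS : 1 ≤ S) {D : ℝ} (hD : 0 ≤ D)
    (x : Fin n → Fin S) :
    √(n : ℝ) * maxDev D (uniformVec S) (frequencies x) = D / 2 * sumAbs (scaledDev x) := by
  rw [sumAbs_scaledDev]
  rcases Nat.eq_zero_or_pos n with rfl | hn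
  -- For `n = 0` the frequencies do not sum to one, but the factor `√n` annihilates both sides.
  · simp
  have hS' : (S : ℝ) ≠ 0 := by positivity
  rw [maxDev_eq_sum_abs hD (by rw [sum_frequencies hn]; simp [uniformVec, hS'])]
  ring

/-! ### The limit law and its tails. -/

/-- The law of the limit in distribution of `√n Z_n`. -/
noncomputable def limitLaw (D : ℝ) (S : ℕ) : ProbabilityMeasure ℝ :=
  ⟨(uniformGaussian S).map fun v => D / 2 * sumAbs v,
    Measure.isProbabilityMeasure_map (by fun_prop)⟩

theorem limitLaw_real_apply (D : ℝ) (S : ℕ) {s : Set ℝ} (hs : MeasurableSet s) :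
    (limitLaw D S : Measure ℝ).real s = (uniformGaussian S).real {v | D / 2 * sumAbs v ∈ s} :=
  map_measureReal_apply (by fun_prop) hs

theorem map_comp_of_hasLaw_empiricalLaw {Ω : Type*} [MeasurableSpace Ω] {P : Measure Ω}
    {n S : ℕ} {phat : Ω → Fin S → ℝ} (h : HasLaw phat (empiricalLaw n (uniformVec S)) P)
    {g : (Fin S → ℝ) → ℝ} (hg : Measurable g) :
    P.map (fun ω => g (phat ω)) = (sampleLaw n S).map fun x => g (frequencies x) := by
  have h1 := AEMeasurable.map_map_of_aemeasurable (μ := P) hg.aemeasurable h.aemeasurable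
  rw [h.map_eq, empiricalLaw_eq_map, Measure.map_map hg .of_discrete] at h1
  exact h1.symm

theorem tendstoInDistribution_limitLaw {Ω : ℕ → Type*} [∀ n, MeasurableSpace (Ω n)]
    (P : ∀ n, Measure (Ω n)) [∀ n, IsProbabilityMeasure (P n)] {S : ℕ} (hS : 1 ≤ S)
    (phat : ∀ n, Ω n → Fin S → ℝ)
    (hphat : ∀ n, HasLaw (phat n) (empiricalLaw n (uniformVec S)) (P n)) {D : ℝ} (hD : 0 ≤ D) :
    TendstoInDistribution
      (fun (n : ℕ) ω => √(n : ℝ) * maxDev D (uniformVec S) (phat n ω)) atTop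
      id P (limitLaw D S : Measure ℝ) where
  forall_aemeasurable n :=
    ((measurable_maxDev hD _).comp_aemeasurable (hphat n).aemeasurable).const_mul _
  aemeasurable_limit := aemeasurable_id
  tendsto := by
    have := fun n => isProbabilityMeasure_sampleLaw n hS
    have h := ProbabilityMeasure.tendsto_map_of_tendsto_of_continuous _ _
      (tendsto_map_scaledDev hS) (f := fun v => D / 2 * sumAbs v) (by fun_prop)
    refine Eq.mpr (congrArg₂ (fun u l => Tendsto u atTop (𝓝 l))
      (funext fun n => Subtype.ext ?_) (Subtype.ext ?_)) h
    · change (P n).map (fun ω => √(n : ℝ) * maxDev D (uniformVec S) (phat n ω)) =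
        ((sampleLaw n S).map scaledDev).map fun v => D / 2 * sumAbs v
      rw [map_comp_of_hasLaw_empiricalLaw (hphat n)
          (g := fun q => √(n : ℝ) * maxDev D (uniformVec S) q)
          ((measurable_maxDev hD _).const_mul _),
        Measure.map_map (by fun_prop) .of_discrete]
      exact congrArg (fun f => Measure.map f (sampleLaw n S))
        (funext (sqrt_mul_maxDev_frequencies hS hD))
    · exact Measure.map_id

theorem limitLaw_lower_tail {D : ℝ} (hD : 0 < D) {S : ℕ} (hS : 1 ≤ S) {δ : ℝ}
    (hδ : δ ∈ Set.Ioo (0 : ℝ) 1) :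
    1 - δ ≤ (limitLaw D S : Measure ℝ).real
      (Set.Ici (D / 2 * (√(2 * ((S : ℝ) - 1) / Real.pi) - √(2 * Real.log (2 / δ))))) := by
  obtain ⟨h0, h1⟩ := hδ
  have hlog : 0 ≤ 2 * Real.log (1 / δ) :=
    mul_nonneg two_pos.le (Real.log_nonneg (by rw [le_div_iff₀ h0]; linarith))
  have hlt : √(2 * Real.log (1 / δ)) < √(2 * Real.log (2 / δ)) := by
    refine Real.sqrt_lt_sqrt hlog (mul_lt_mul_of_pos_left (Real.log_lt_log (by positivity) ?_)
      two_pos)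
    gcongr
    norm_num
  have h := uniformGaussian_lower_tail hS (Real.sqrt_nonneg _) hlt
  have he : Real.exp (-√(2 * Real.log (1 / δ)) ^ 2 / 2) = δ := by
    rw [Real.sq_sqrt hlog, one_div, Real.log_inv,
      show -(2 * -Real.log δ) / 2 = Real.log δ by ring, Real.exp_log h0]
  rw [he] at h
  rw [limitLaw_real_apply _ _ measurableSet_Ici]
  refine h.trans (measureReal_mono fun v hv => ?_)
  rw [Set.mem_ofPred_eq] at hv ⊢
  exact mul_le_mul_of_nonneg_left hv (by positivity)

theorem limitLaw_lower_tail_of_two_le {D : ℝ} (hD : 2 ≤ D) {S : ℕ} (hS : 1 ≤ S) {δ : ℝ}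
    (hδ : δ ∈ Set.Ioo (0 : ℝ) 1) :
    1 - δ ≤ (limitLaw D S : Measure ℝ).real
      (Set.Ici (√(2 * ((S : ℝ) - 1) / Real.pi) - √(2 * Real.log (2 / δ)))) := by
  set a := √(2 * ((S : ℝ) - 1) / Real.pi) - √(2 * Real.log (2 / δ)) with ha
  -- For `a ≥ 0` the factor `D / 2 ≥ 1` only raises the threshold; for `a ≤ 0` the event is certain.
  rcases le_total 0 a with h0 | h0
  · refine (limitLaw_lower_tail (by linarith) hS hδ).trans 
      (measureReal_mono (Set.Ici_subset_Ici.2 ?_))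
    rw [← ha]
    nlinarith
  · rw [limitLaw_real_apply _ _ measurableSet_Ici]
    have h : {v : EuclideanSpace ℝ (Fin S) | D / 2 * sumAbs v ∈ Set.Ici a} = Set.univ :=
      Set.eq_univ_of_forall fun v =>
        h0.trans (mul_nonneg (by linarith) (sumAbs_nonneg v))
    rw [h, probReal_univ]
    linarith [hδ.1]

theorem mul_limitLaw_real_Ici_le {D : ℝ} (hD : 0 ≤ D) {S : ℕ} (hS : 1 ≤ S) (x : ℝ) :
    x * (limitLaw D S : Measure ℝ).real (Set.Ici x) ≤
      D / 2 * √(2 * ((S : ℝ) - 1) / Real.pi) := by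
  rw [limitLaw_real_apply _ _ measurableSet_Ici, ← integral_sumAbs_uniformGaussian hS,
    ← integral_const_mul]
  exact mul_meas_ge_le_integral_of_nonneg
    (ae_of_all _ fun v => mul_nonneg (by positivity) (sumAbs_nonneg v))
    ((integrable_sumAbs_uniformGaussian S).const_mul _) x

/-! ### Growth of the quantiles. -/

theorem quantile_mem_Icc {ν : Measure ℝ} [IsFiniteMeasure ν] {α a b : ℝ}
    (ha : ν.real (Set.Iio a) < α) (hb : α ≤ ν.real (Set.Iic b)) :
    quantile ν α ∈ Set.Icc a b := by
  have h : ∀ x ∈ {x | α ≤ ν.real (Set.Iic x)}, a ≤ x := fun x hx => by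
    by_contra hlt
    exact absurd (hx.trans (measureReal_mono (Set.Iic_subset_Iio.2 (not_le.1 hlt)))) ha.not_ge
  exact ⟨le_csInf ⟨b, hb⟩ h, csInf_le ⟨a, h⟩ hb⟩

theorem sqrt_div_two_le {S : ℕ} (hS : 2 ≤ S) :
    √(S : ℝ) / 2 ≤ √(2 * ((S : ℝ) - 1) / Real.pi) := by
  have hS' : (2 : ℝ) ≤ S := by exact_mod_cast hS
  refine Real.le_sqrt_of_sq_le ?_
  rw [div_pow, Real.sq_sqrt (by positivity), le_div_iff₀ Real.pi_pos]
  nlinarith [Real.pi_lt_four]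

theorem tendsto_sqrt_natCast_atTop : Tendsto (fun S : ℕ => √(S : ℝ)) atTop atTop :=
  Real.tendsto_sqrt_atTop.comp tendsto_natCast_atTop_atTop

theorem quantile_limitLaw_bounds {D : ℝ} (hD : 0 < D) {α : ℝ} (hα : α ∈ Set.Ioo (0 : ℝ) 1) :
    ∃ c C : ℝ, 0 < c ∧ 0 < C ∧ ∀ᶠ S : ℕ in atTop,
      c * √(S : ℝ) ≤ quantile (limitLaw D S : Measure ℝ) α ∧
      quantile (limitLaw D S : Measure ℝ) α ≤ C * √(S : ℝ) := by
  obtain ⟨h0, h1⟩ := hα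
  have h1' : 0 < 1 - α := by linarith
  -- The mean of `‖G‖₁` is at least `√S / 2` and the tail loses at most `√S / 4`, whence `D / 8`.
  -- The upper constant makes Markov's bound equal to `1 - α`.
  refine ⟨D / 8, D / (2 * (1 - α)), by positivity, by positivity, ?_⟩
  filter_upwards [eventually_ge_atTop 2, tendsto_sqrt_natCast_atTop.eventually_ge_atTop
    (4 * √(2 * Real.log (2 / (α / 2))))] with S hS hS4
  have hS1 : 1 ≤ S := by omega
  have hSpos : 0 < √(S : ℝ) := by positivity
  refine quantile_mem_Icc ?_ ?_
  -- Taking `α / 2` gives the strict inequality that `quantile_mem_Icc` requires.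
  · have h := limitLaw_lower_tail hD hS1 (δ := α / 2) ⟨by linarith, by linarith⟩
    have h2 : (limitLaw D S : Measure ℝ).real
        (Set.Ici (D / 2 * (√(2 * ((S : ℝ) - 1) / Real.pi) - √(2 * Real.log (2 / (α / 2)))))) ≤
        (limitLaw D S : Measure ℝ).real (Set.Iio (D / 8 * √(S : ℝ)))ᶜ := by
      rw [Set.compl_Iio]
      refine measureReal_mono (Set.Ici_subset_Ici.2 ?_)
      rw [show D / 8 * √(S : ℝ) = D / 2 * (√(S : ℝ) / 4) by ring]
      refine mul_le_mul_of_nonneg_left ?_ (by positivity)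
      linarith [sqrt_div_two_le hS]
    rw [probReal_compl_eq_one_sub measurableSet_Iio] at h2
    linarith
  · have h := mul_limitLaw_real_Ici_le hD.le hS1 (D / (2 * (1 - α)) * √(S : ℝ))
    have hm : √(2 * ((S : ℝ) - 1) / Real.pi) ≤ √(S : ℝ) := by
      refine Real.sqrt_le_sqrt ?_
      rw [div_le_iff₀ Real.pi_pos]
      nlinarith [Real.pi_gt_three, (Nat.cast_nonneg S : (0 : ℝ) ≤ S)]
    have h2 : (limitLaw D S : Measure ℝ).real (Set.Ici (D / (2 * (1 - α)) * √(S : ℝ))) ≤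
        1 - α := by
      have h3 := h.trans (mul_le_mul_of_nonneg_left hm (by positivity : 0 ≤ D / 2))
      rw [show D / 2 * √(S : ℝ) = D / (2 * (1 - α)) * √(S : ℝ) * (1 - α) by field_simp] at h3
      exact le_of_mul_le_mul_left h3 (by positivity)
    have h4 := measureReal_mono (μ := (limitLaw D S : Measure ℝ))
      (Set.compl_subset_comm.1 (Set.compl_Iic.trans_subset
        (Set.Ioi_subset_Ici_self (a := D / (2 * (1 - α)) * √(S : ℝ)))))
    rw [probReal_compl_eq_one_sub measurableSet_Ici] at h4
    linarith

/-! ### Failure of the dimension-free bound. -/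

theorem eventually_lt_prob_sumAbs_scaledDev {δ : ℝ} (hδ : δ < 1) (K : ℝ) :
    ∀ᶠ S : ℕ in atTop, ∀ᶠ n : ℕ in atTop,
      δ < (sampleLaw n S).real {x | K ≤ sumAbs (scaledDev x)} := by
  have ht : Tendsto (fun t : ℝ => Real.exp (-t ^ 2 / 2)) atTop (𝓝 0) := by
    refine Real.tendsto_exp_atBot.comp ?_
    simp_rw [neg_div]
    exact tendsto_neg_atTop_atBot.comp ((tendsto_pow_atTop two_ne_zero).atTop_div_const two_pos)
  obtain ⟨t, htδ, ht0⟩ := ((ht.eventually_lt_const (sub_pos.2 hδ)).and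
    (eventually_ge_atTop 0)).exists
  -- This puts the Gaussian mean, at least `√S / 2`, above `K + t`, hence also the sample means for
  -- large `n`.
  filter_upwards [eventually_ge_atTop 2, tendsto_sqrt_natCast_atTop.eventually_gt_atTop
    (2 * (K + t))] with S hS hSK
  have hS1 : 1 ≤ S := by omega
  have := fun n => isProbabilityMeasure_sampleLaw n hS1
  filter_upwards [eventually_ge_atTop 1, eventually_lt_integral_sumAbs_scaledDev hS1 (a := K + t)
    (by linarith [sqrt_div_two_le hS])] with n hn hE
  have h := sumAbs_scaledDev_lower_tail hn hS1 ht0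
  refine lt_of_lt_of_le (by linarith) (h.trans (measureReal_mono fun x hx => ?_))
  simp only [Set.mem_ofPred_eq] at hx ⊢
  linarith

theorem hasLaw_real_setOf_le_sum_abs {Ω : Type*} [MeasurableSpace Ω] {P : Measure Ω}
    {n S : ℕ} (hn : 1 ≤ n) {phat : Ω → Fin S → ℝ}
    (h : HasLaw phat (empiricalLaw n (uniformVec S)) P) (K : ℝ) :
    P.real {ω | K / √(n : ℝ) ≤ ∑ i, |phat ω i - uniformVec S i|} =
      (sampleLaw n S).real {x | K ≤ sumAbs (scaledDev x)} := by
  have hn' : 0 < √(n : ℝ) := by positivity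
  have hg : Measurable fun q : Fin S → ℝ => ∑ i, |q i - uniformVec S i| := by fun_prop
  have h1 := congrArg (fun μ => μ.real (Set.Ici (K / √(n : ℝ))))
    (map_comp_of_hasLaw_empiricalLaw h hg)
  have hm : AEMeasurable (fun ω => ∑ i, |phat ω i - uniformVec S i|) P :=
    hg.comp_aemeasurable h.aemeasurable
  rw [map_measureReal_apply_of_aemeasurable hm measurableSet_Ici,
    map_measureReal_apply .of_discrete measurableSet_Ici] at h1
  refine h1.trans (congrArg _ (Set.ext fun x => ?_))
  simp only [Set.mem_preimage, Set.mem_Ici, Set.mem_ofPred_eq, sumAbs_scaledDev,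
    div_le_iff₀' hn']

theorem mainTheorem1
    {Ω : ℕ → ℕ → Type*} [∀ S n, MeasurableSpace (Ω S n)]
    (P : ∀ S n, Measure (Ω S n)) [∀ S n, IsProbabilityMeasure (P S n)]
    (phat : ∀ S n, Ω S n → Fin S → ℝ)
    (hphat : ∀ S n, 1 ≤ S → HasLaw (phat S n) (empiricalLaw n (uniformVec S)) (P S n))
    (D : ℝ) (hD : 0 < D) :
    -- `ν S` is the law of `Z_S`, the limit in distribution of `√n Z_n`
    (∃ ν : ℕ → ProbabilityMeasure ℝ,
      (∀ S, 1 ≤ S →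
        TendstoInDistribution
          (fun (n : ℕ) ω => √(n : ℝ) * maxDev D (uniformVec S) (phat S n ω)) atTop
          id (P S) (ν S : Measure ℝ)) ∧
      -- the anticoncentration inequality
      (∀ S, 1 ≤ S → ∀ δ ∈ Set.Ioo (0 : ℝ) 1,
        1 - δ ≤ (ν S : Measure ℝ).real
          {z | D / 2 * (√(2 * ((S : ℝ) - 1) / Real.pi) - √(2 * Real.log (2 / δ))) ≤ z}) ∧
      -- the same inequality without the factor `D / 2`, for `D ≥ 2`
      (2 ≤ D → ∀ S, 1 ≤ S → ∀ δ ∈ Set.Ioo (0 : ℝ) 1,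
        1 - δ ≤ (ν S : Measure ℝ).real
          {z | √(2 * ((S : ℝ) - 1) / Real.pi) - √(2 * Real.log (2 / δ)) ≤ z}) ∧
      -- every quantile of `Z_S` grows like `√S`
      (∀ α ∈ Set.Ioo (0 : ℝ) 1, ∃ c C : ℝ, 0 < c ∧ 0 < C ∧ ∀ᶠ S : ℕ in atTop,
        c * √(S : ℝ) ≤ quantile (ν S : Measure ℝ) α ∧
        quantile (ν S : Measure ℝ) α ≤ C * √(S : ℝ))) ∧
    -- the dimension-free bound `ℙ(‖phat_n - p‖₁ ≥ √(2 log (1/δ) / n)) ≤ δ` fails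
    (∀ δ ∈ Set.Ioo (0 : ℝ) 1, ∀ᶠ S : ℕ in atTop, ∀ᶠ n : ℕ in atTop,
      δ < (P S n).real
        {ω | √(2 * Real.log (1 / δ) / (n : ℝ)) ≤ ∑ i, |phat S n ω i - uniformVec S i|}) := by
  refine ⟨⟨limitLaw D, fun S hS => ?_, fun S hS δ hδ => limitLaw_lower_tail hD hS hδ,
    fun hD2 S hS δ hδ => limitLaw_lower_tail_of_two_le hD2 hS hδ,
    fun α hα => quantile_limitLaw_bounds hD hα⟩, fun δ hδ => ?_⟩
  · exact tendstoInDistribution_limitLaw (P S) hS (phat S) (fun n => hphat S n hS) hD.le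
  · filter_upwards [eventually_ge_atTop 1,
      eventually_lt_prob_sumAbs_scaledDev hδ.2 √(2 * Real.log (1 / δ))] with S hS h
    filter_upwards [eventually_ge_atTop 1, h] with n hn hn2
    rw [Real.sqrt_div' _ (Nat.cast_nonneg n), hasLaw_real_setOf_le_sum_abs hn (hphat S n hS)]
    exact hn2
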